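/- Let $F$ be the set of finite non-empty subsets of $\mathbb{C}$, with the topology whose basic open sets are $U_{\{O_i\}_{i\in I},N}=\{A\in F : A\cap O_i\neq\emptyset \text{ for all } i\in I,\ A\subseteq N\}$, for $I$ finite and $O_i,N\subseteq\mathbb{C}$ open; such a set is in normal form if $N=\bigcup_{i\in I} O_i$. Let $K$ be a subfield of $\mathbb{R}$ (for instance $\mathbb{Q}$ or $\mathbb{R}$), and let $R$ be the Riesz space over $K$ of functions $\mathbb{C}\to\mathbb{R}$ generated by $1$, $\mathrm{Re}$ and $\mathrm{Im}$, that is, the least $K$-linear space of functions that contains these three and is closed under pointwise maximum and minimum. In the topological model over $F$ (the Heyting-valued model whose truth values are the open subsets of $F$; $U\Vdash\varphi$ means that $U$ is contained in the truth value of $\varphi$), the internal set $R$ consists of the same functions, with the operations inherited from outside, and the truth value of $r=s$ is the union of all $U_{\{O_i\},N}$ such that $r(z)=s(z)$ for all $z\in N$. Internally, $r\le s$ means $r\vee s=s$, and, for $q\in\mathbb{Q}$, $q>r$ means that $r\le p\cdot 1$ for some rational $p<q$. Then $F\Vdash$ "$R$ is a normable Riesz space". That is, $F$ forces: $R$ is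 a Riesz space over $K$; $1$ is a strong unit of $R$ (for each $r\in R$ there is $n\in\mathbb{N}$ with $-n\cdot 1\le r\le n\cdot 1$); $q\mapsto q\cdot 1$ is an order embedding of $\mathbb{Q}$ into $R$; and for each $r\in R$ the set $U(r)=\{q\in\mathbb{Q} : q>r\}$ is a real number, i.e. a located upper cut: it is inhabited, some rational is not in it, $q\in U(r)$ if and only if $p\in U(r)$ for some $p<q$, and whenever $p<q$, either $p\notin U(r)$ or $q\in U(r)$. Moreover, writing $\sup r$ for the internal real number given by $U(r)$: for every $r\in R$, $A\in F$ and $\varepsilon>0$ there are finitely many pairwise disjoint open sets $O_i\subseteq\mathbb{C}$ ($i\in I$) such that the open set $U$ in normal form with positive information $\{O_i\}_{i\in I}$ contains $A$, the numbers $l=\max_{i}\inf_{z\in O_i} r(z)$ and $u=\sup_{z\in\bigcup_i O_i} r(z)$ exist and satisfy $u-l<\varepsilon$, and $U\Vdash l\le \sup r\le u$. -/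

import Mathlib

open TopologicalSpace

noncomputable section

namespace TopModel

/-! ### Heyting-valued sets and their internal logic

Truth values are the elements of a complete Heyting algebra `Ω` (below: the open sets of a space).
Conjunction, disjunction, implication and negation are `⊓`, `⊔`, `⇨`, `ᶜ`. -/

/-- `U ⊩ φ`, for a condition `U` and a statement with truth value `φ`. -/
def Forces {Ω : Type} [Order.Frame Ω] (U φ : Ω) : Prop := U ≤ φ

/-- The truth value of a statement about the ambient universe. -/
def ext {Ω : Type} [Order.Frame Ω] (p : Prop) : Ω := ⨆ _ : p, ⊤

/-- The truth value of a biconditional. -/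
def biImp {Ω : Type} [Order.Frame Ω] (φ ψ : Ω) : Ω := (φ ⇨ ψ) ⊓ (ψ ⇨ φ)

/-- A Heyting-valued set over `Ω`: a collection of names, with an `Ω`-valued equality relation.
The truth value of `x` being a member is that of `x = x`. -/
structure HSet (Ω : Type) [Order.Frame Ω] where
  /-- the names of members -/
  carrier : Type
  /-- the truth value of equality -/
  eq : carrier → carrier → Ω
  symm : ∀ x y, eq x y ≤ eq y x
  trans : ∀ x y z, eq x y ⊓ eq y z ≤ eq x z

namespace HSet

variable {Ω : Type} [Order.Frame Ω]

/-- The truth value of `∀ x ∈ X, φ x`. -/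
def all (X : HSet Ω) (φ : X.carrier → Ω) : Ω := ⨅ x, X.eq x x ⇨ φ x

/-- The truth value of `∃ x ∈ X, φ x`. -/
def ex (X : HSet Ω) (φ : X.carrier → Ω) : Ω := ⨆ x, X.eq x x ⊓ φ x

/-- The canonical image in the model of a set of the ambient universe. -/
abbrev check (Ω : Type) [Order.Frame Ω] (α : Type) : HSet Ω where
  carrier := α
  eq a b := ext (a = b)
  symm a b := iSup_le fun h => le_iSup_of_le h.symm le_rfl
  trans a b c := by
    unfold ext
    rw [iSup_inf_eq]
    refine iSup_le fun h => ?_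
    subst h
    exact inf_le_right

end HSet

/-! ### Internal reals as located upper cuts of rationals -/

section Cuts

variable {Ω : Type} [Order.Frame Ω]

/-- The truth value of `∀ q ∈ ℚ, φ q`. -/
def allQ (φ : ℚ → Ω) : Ω := (HSet.check Ω ℚ).all φ

/-- The truth value of `∃ q ∈ ℚ, φ q`. -/
def exQ (φ : ℚ → Ω) : Ω := (HSet.check Ω ℚ).ex φ

/-- The truth value of: the set `S` of rationals is a real number, given as a located upper cut.
That is: `S` is inhabited; some rational is not in `S`; `q ∈ S` iff `p ∈ S` for some `p < q`;
and whenever `p < q`, either `p ∉ S` or `q ∈ S`. -/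
def isLocatedUpperCut (S : ℚ → Ω) : Ω :=
  exQ S
    ⊓ exQ (fun q => (S q)ᶜ)
    ⊓ allQ (fun q => biImp (S q) (exQ fun p => ext (p < q) ⊓ S p))
    ⊓ allQ (fun p => allQ fun q => ext (p < q) ⇨ ((S p)ᶜ ⊔ S q))

/-- The truth value of: the real number with upper cut `S` is at most `u`. -/
def cutLe (S : ℚ → Ω) (u : ℝ) : Ω := allQ fun q => ext (u < (q : ℝ)) ⇨ S q

/-- The truth value of: the real number with upper cut `S` is at least `l`. -/
def leCut (l : ℝ) (S : ℚ → Ω) : Ω := allQ fun q => S q ⇨ ext (l ≤ (q : ℝ))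

end Cuts

/-! ### Riesz spaces inside the model -/

/-- A set in the model with the operations of a Riesz space over (the image in the model of) `𝕜`,
and a distinguished element `one`.  This is only the signature; the axioms are stated below, as
truth values. -/
structure RieszSig (Ω : Type) [Order.Frame Ω] (𝕜 : Type) where
  /-- the underlying set of the model -/
  X : HSet Ω
  /-- zero vector -/
  zero : X.carrier
  /-- distinguished element -/
  one : X.carrier
  /-- vector addition -/
  add : X.carrier → X.carrier → X.carrier
  /-- scalar multiplication -/
  smul : 𝕜 → X.carrier → X.carrier
  /-- join -/
  sup : X.carrier → X.carrier → X.carrier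
  /-- meet -/
  inf : X.carrier → X.carrier → X.carrier

namespace RieszSig

variable {Ω : Type} [Order.Frame Ω] {𝕜 : Type} [Field 𝕜] [LinearOrder 𝕜] (R : RieszSig Ω 𝕜)

/-- The truth value of `f ≤ g`, that is, of `f ∨ g = g`. -/
def le (f g : R.X.carrier) : Ω := R.X.eq (R.sup f g) g

/-- The truth value of `∀ k ∈ 𝕜, φ k`. -/
def allScalar (φ : 𝕜 → Ω) : Ω := (HSet.check Ω 𝕜).all φ

/-- The constants are members and the operations are well-defined functions. -/
def opsWellDefined : Ω :=
  R.X.eq R.zero R.zero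
    ⊓ R.X.eq R.one R.one
    ⊓ (R.X.all fun f => R.X.all fun f' => R.X.all fun g => R.X.all fun g' =>
        (R.X.eq f f' ⊓ R.X.eq g g') ⇨
          (R.X.eq (R.add f g) (R.add f' g') ⊓ R.X.eq (R.sup f g) (R.sup f' g')
            ⊓ R.X.eq (R.inf f g) (R.inf f' g')))
    ⊓ (allScalar fun k : 𝕜 => R.X.all fun f => R.X.all fun f' =>
        R.X.eq f f' ⇨ R.X.eq (R.smul k f) (R.smul k f'))

/-- The axioms of a vector space over `𝕜`. -/
def vectorSpaceAxioms : Ω :=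
  (R.X.all fun f => R.X.all fun g => R.X.eq (R.add f g) (R.add g f))
    ⊓ (R.X.all fun f => R.X.all fun g => R.X.all fun h =>
        R.X.eq (R.add (R.add f g) h) (R.add f (R.add g h)))
    ⊓ (R.X.all fun f => R.X.eq (R.add f R.zero) f)
    ⊓ (R.X.all fun f => R.X.eq (R.add f (R.smul (-1) f)) R.zero)
    ⊓ (R.X.all fun f => R.X.eq (R.smul 1 f) f)
    ⊓ (allScalar fun k : 𝕜 => allScalar fun l : 𝕜 => R.X.all fun f =>
        R.X.eq (R.smul (k * l) f) (R.smul k (R.smul l f)))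
    ⊓ (allScalar fun k : 𝕜 => allScalar fun l : 𝕜 => R.X.all fun f =>
        R.X.eq (R.smul (k + l) f) (R.add (R.smul k f) (R.smul l f)))
    ⊓ (allScalar fun k : 𝕜 => R.X.all fun f => R.X.all fun g =>
        R.X.eq (R.smul k (R.add f g)) (R.add (R.smul k f) (R.smul k g)))

/-- The axioms of a lattice. -/
def latticeAxioms : Ω :=
  (R.X.all fun f => R.X.all fun g =>
      R.X.eq (R.sup f g) (R.sup g f) ⊓ R.X.eq (R.inf f g) (R.inf g f)
        ⊓ R.X.eq (R.sup f (R.inf f g)) f ⊓ R.X.eq (R.inf f (R.sup f g)) f)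
    ⊓ (R.X.all fun f => R.X.all fun g => R.X.all fun h =>
        R.X.eq (R.sup (R.sup f g) h) (R.sup f (R.sup g h))
          ⊓ R.X.eq (R.inf (R.inf f g) h) (R.inf f (R.inf g h)))

/-- The order is compatible with the vector space structure. -/
def orderAxioms : Ω :=
  (R.X.all fun f => R.X.all fun g => R.X.all fun h =>
      R.le f g ⇨ R.le (R.add f h) (R.add g h))
    ⊓ (allScalar fun k : 𝕜 => R.X.all fun f => R.X.all fun g =>
        (ext (0 ≤ k) ⊓ R.le f g) ⇨ R.le (R.smul k f) (R.smul k g))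

/-- The truth value of: `R` is a Riesz space over `𝕜`. -/
def isRieszSpace : Ω :=
  R.opsWellDefined ⊓ R.vectorSpaceAxioms ⊓ R.latticeAxioms ⊓ R.orderAxioms

/-- The multiple `q · 1` of the distinguished element, for rational `q`. -/
def rat (q : ℚ) : R.X.carrier := R.smul (q : 𝕜) R.one

/-- The truth value of: `1` is a strong unit. -/
def oneIsStrongUnit : Ω :=
  R.X.all fun f => (HSet.check Ω ℕ).ex fun n : ℕ =>
    R.le (R.rat (-(n : ℚ))) f ⊓ R.le f (R.rat (n : ℚ))

/-- The truth value of: `q ↦ q · 1` is an embedding of the ordered set `ℚ` into `R`. -/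
def ratEmbeds : Ω :=
  allQ fun p => allQ fun q => biImp (ext (p ≤ q)) (R.le (R.rat p) (R.rat q))

/-- The set `U(f) = {q ∈ ℚ | q > f}` of the model, where `q > f` is the strict order induced by the
unit: `f ≤ p · 1` for some rational `p < q`. -/
def upperCut (f : R.X.carrier) (q : ℚ) : Ω :=
  exQ fun p => ext (p < q) ⊓ R.le f (R.rat p)

/-- The truth value of: `R` is a normable Riesz space.  That is, `R` is a Riesz space, `1` is a
strong unit of it and induces an embedding of `ℚ`, and for each `f ∈ R` the set `U(f)` is a real
number. -/
def isNormable : Ω :=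
  R.isRieszSpace ⊓ R.oneIsStrongUnit ⊓ R.ratEmbeds
    ⊓ R.X.all fun f => isLocatedUpperCut (R.upperCut f)

end RieszSig

/-! ### The space of finite non-empty sets of complex numbers -/

/-- Finite, non-empty subsets of `ℂ`. -/
def FinSub : Type := {A : Finset ℂ // A.Nonempty}

/-- The set of all `A` that meet each `O i` and are contained in `N`. -/
def basicSet {n : ℕ} (O : Fin n → Opens ℂ) (N : Opens ℂ) : Set FinSub :=
  {A | (∀ i, ∃ z ∈ A.1, z ∈ O i) ∧ ∀ z ∈ A.1, z ∈ N}

/-- The topology in which the sets `basicSet O N` are the basic open sets. -/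
instance : TopologicalSpace FinSub :=
  generateFrom {S | ∃ (n : ℕ) (O : Fin n → Opens ℂ) (N : Opens ℂ), S = basicSet O N}

/-- The basic open set with positive information `O` and negative information `N`. -/
def basicOpen {n : ℕ} (O : Fin n → Opens ℂ) (N : Opens ℂ) : Opens FinSub :=
  ⟨basicSet O N, isOpen_generateFrom_of_mem ⟨n, O, N, rfl⟩⟩

/-- The open set in normal form with positive information `O`. -/
def normalOpen {n : ℕ} (O : Fin n → Opens ℂ) : Opens FinSub := basicOpen O (⨆ i, O i)

/-! ### The Riesz space of functions, outside and inside the model -/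

/-- The Riesz space over `K` of functions `ℂ → ℝ` generated by `1`, `Re` and `Im`: the least
`K`-linear subspace that contains them and is closed under pointwise maximum and minimum. -/
def extR (K : Subfield ℝ) : Submodule K (ℂ → ℝ) :=
  sInf {V | (1 : ℂ → ℝ) ∈ V ∧ Complex.re ∈ V ∧ Complex.im ∈ V ∧
    ∀ f ∈ V, ∀ g ∈ V, f ⊔ g ∈ V ∧ f ⊓ g ∈ V}

theorem one_mem_extR (K : Subfield ℝ) : (1 : ℂ → ℝ) ∈ extR K :=
  Submodule.mem_sInf.2 fun _ hV => hV.1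

theorem sup_inf_mem_extR {K : Subfield ℝ} {f g : ℂ → ℝ} (hf : f ∈ extR K) (hg : g ∈ extR K) :
    f ⊔ g ∈ extR K ∧ f ⊓ g ∈ extR K := by
  simp only [extR, Submodule.mem_sInf] at hf hg ⊢
  exact ⟨fun V hV => (hV.2.2.2 f (hf V hV) g (hg V hV)).1,
    fun V hV => (hV.2.2.2 f (hf V hV) g (hg V hV)).2⟩

/-- The truth value of `r = s`: the union of the basic open sets on whose negative information
the two functions agree. -/
def eqValue (r s : ℂ → ℝ) : Opens FinSub :=
  sSup {U | ∃ (n : ℕ) (O : Fin n → Opens ℂ) (N : Opens ℂ),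
    U = basicOpen O N ∧ ∀ z ∈ N, r z = s z}

theorem mem_eqValue {r s : ℂ → ℝ} {A : FinSub} :
    A ∈ eqValue r s ↔ ∃ N : Opens ℂ, (∀ z ∈ A.1, z ∈ N) ∧ ∀ z ∈ N, r z = s z := by
  constructor
  · intro h
    obtain ⟨U, ⟨n, O, N, rfl, hN⟩, hA⟩ := Opens.mem_sSup.1 h
    exact ⟨N, hA.2, hN⟩
  · rintro ⟨N, hA, hN⟩
    exact Opens.mem_sSup.2 ⟨basicOpen (Fin.elim0 : Fin 0 → Opens ℂ) N,
      ⟨0, _, N, rfl, hN⟩, fun i => i.elim0, hA⟩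

/-- A non-empty basic open set forces `r = s` iff `r` and `s` agree on its negative information. -/
theorem forces_eqValue_iff {n : ℕ} {O : Fin n → Opens ℂ} {N : Opens ℂ}
    (hU : ∃ A, A ∈ basicOpen O N) (r s : ℂ → ℝ) :
    Forces (basicOpen O N) (eqValue r s) ↔ ∀ z ∈ N, r z = s z := by
  classical
  constructor
  · intro h z hz
    obtain ⟨A, hA⟩ := hU
    have hB : (⟨insert z A.1, Finset.insert_nonempty z A.1⟩ : FinSub) ∈ basicOpen O N := by
      refine ⟨fun i => ?_, fun w hw => ?_⟩
      · obtain ⟨w, hw, hwO⟩ := hA.1 i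
        exact ⟨w, Finset.mem_insert_of_mem hw, hwO⟩
      · rcases Finset.mem_insert.1 hw with rfl | hw
        · exact hz
        · exact hA.2 w hw
    obtain ⟨N', hN', hrs⟩ := mem_eqValue.1 (h hB)
    exact hrs z (hN' z (Finset.mem_insert_self z A.1))
  · intro h A hA
    exact mem_eqValue.2 ⟨N, hA.2, h⟩

/-- The underlying set of the Riesz space inside the topological model over `FinSub`: its members
are the functions in `extR K`, with equality as above. -/
def intRSet (K : Subfield ℝ) : HSet (Opens FinSub) where
  carrier := extR K
  eq := fun r s => eqValue r.1 s.1
  symm := by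
    intro r s A hA
    obtain ⟨N, h1, h2⟩ := mem_eqValue.1 hA
    exact mem_eqValue.2 ⟨N, h1, fun z hz => (h2 z hz).symm⟩
  trans := by
    intro r s t A hA
    obtain ⟨N, h1, h2⟩ := mem_eqValue.1 hA.1
    obtain ⟨M, h3, h4⟩ := mem_eqValue.1 hA.2
    exact mem_eqValue.2 ⟨N ⊓ M, fun z hz => ⟨h1 z hz, h3 z hz⟩,
      fun z hz => (h2 z hz.1).trans (h4 z hz.2)⟩

/-- The Riesz space inside the topological model over `FinSub`: the operations are inherited from
the functions outside. -/
def intR (K : Subfield ℝ) : RieszSig (Opens FinSub) K where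
  X := intRSet K
  zero := (0 : extR K)
  one := (⟨1, one_mem_extR K⟩ : extR K)
  add := fun r s : extR K => (r + s : extR K)
  smul := fun (k : K) (r : extR K) => (k • r : extR K)
  sup := fun r s : extR K => (⟨r.1 ⊔ s.1, (sup_inf_mem_extR r.2 s.2).1⟩ : extR K)
  inf := fun r s : extR K => (⟨r.1 ⊓ s.1, (sup_inf_mem_extR r.2 s.2).2⟩ : extR K)

end TopModel

end

namespace TopModel

/-! ### Calculus of truth values. -/

section Logic

variable {Ω : Type} [Order.Frame Ω]

/-! Truth values are open sets, so forcing can be tested at each finite set `A`. Algebraic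
identities and order laws hold pointwise for real functions, hence are forced everywhere. The
analytic content is that every `r` in `extR K` is continuous, so a strict bound at the points of `A`
extends to a neighbourhood. By `mem_intR_upperCut`, the cut of `r` at `A` is then that of the
maximum of `r` on `A`. The cut is located because having a point where `r > p` is an open condition
on `A` and refutes `p > r` (`mem_compl_intR_upperCut`).

For the estimates, the points of `A` are surrounded by small disjoint open sets on which `r` is
nearly constant. Meeting each of them bounds the supremum below; lying in their union bounds it
above. -/

theorem ext_of_true {p : Prop} (h : p) : (ext p : Ω) = ⊤ := by simp [ext, h]

theorem HSet.le_all {X : HSet Ω} {φ : X.carrier → Ω} {c : Ω} (h : ∀ x, c ≤ φ x) : c ≤ X.all φ :=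
  le_iInf fun x => le_himp_iff.2 (inf_le_left.trans (h x))

theorem HSet.check_eq_self {α : Type} (x : α) : (HSet.check Ω α).eq x x = ⊤ := ext_of_true rfl

theorem HSet.check_ex {α : Type} (φ : α → Ω) : (HSet.check Ω α).ex φ = ⨆ x, φ x := by
  refine iSup_congr fun x => ?_
  rw [HSet.check_eq_self, top_inf_eq]

theorem exQ_eq_iSup (φ : ℚ → Ω) : exQ φ = ⨆ q, φ q := HSet.check_ex φ

theorem le_allQ {φ : ℚ → Ω} {c : Ω} (h : ∀ q, c ≤ φ q) : c ≤ allQ φ :=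
  HSet.le_all (X := HSet.check Ω ℚ) h

theorem le_biImp_of_eq {φ ψ c : Ω} (h : φ = ψ) : c ≤ biImp φ ψ := by
  simp [biImp, h]

theorem RieszSig.le_allScalar {𝕜 : Type} {φ : 𝕜 → Ω} {c : Ω} (h : ∀ k, c ≤ φ k) :
    c ≤ RieszSig.allScalar φ :=
  HSet.le_all (X := HSet.check Ω 𝕜) h

end Logic

/-! ### Truth values tested at points. -/

theorem mem_ext {α : Type} [TopologicalSpace α] {p : Prop} {a : α} :
    a ∈ (ext p : Opens α) ↔ p := by
  simp [ext]

theorem mem_exQ {α : Type} [TopologicalSpace α] {φ : ℚ → Opens α} {a : α} :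
    a ∈ exQ φ ↔ ∃ q, a ∈ φ q := by
  rw [exQ_eq_iSup, Opens.mem_iSup]

/-- Negation is the interior of the complement, so a whole neighbourhood has to avoid `U`. -/
theorem mem_compl_of_disjoint {α : Type} [TopologicalSpace α] {U V : Opens α} {a : α}
    (ha : a ∈ V) (h : ∀ b ∈ V, b ∉ U) : a ∈ Uᶜ := by
  have : V ≤ Uᶜ := by
    rw [le_compl_iff_disjoint_right, disjoint_iff_inf_le]
    exact fun b hb => (h b hb.1 hb.2).elim
  exact this ha

theorem isOpen_meets {V : Set ℂ} (hV : IsOpen V) :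
    IsOpen {A : FinSub | ∃ z ∈ A.1, z ∈ V} := by
  convert (basicOpen (fun _ : Fin 1 => (⟨V, hV⟩ : Opens ℂ)) ⊤).isOpen using 1
  ext A
  exact ⟨fun h => ⟨fun _ => h, fun _ _ => trivial⟩, fun h => h.1 0⟩

variable {K : Subfield ℝ}

/-- The continuous functions are one of the subspaces whose intersection is `extR K`. -/
theorem continuous_of_mem_extR {f : ℂ → ℝ} (hf : f ∈ extR K) : Continuous f := by
  let V : Submodule K (ℂ → ℝ) :=
    { carrier := {f | Continuous f}
      add_mem' := fun ha hb => Continuous.add ha hb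
      zero_mem' := continuous_const
      smul_mem' := fun c _ hg => Continuous.mul (f := fun _ : ℂ => (c : ℝ)) continuous_const hg }
  exact Submodule.mem_sInf.1 hf V ⟨continuous_const, Complex.continuous_re,
    Complex.continuous_im, fun f hf g hg => ⟨Continuous.sup hf hg, Continuous.inf hf hg⟩⟩

theorem eqValue_mono {f g f' g' : ℂ → ℝ} (h : ∀ z, f z = g z → f' z = g' z) :
    eqValue f g ≤ eqValue f' g' := fun _ hA =>
  let ⟨N, h1, h2⟩ := mem_eqValue.1 hA
  mem_eqValue.2 ⟨N, h1, fun z hz => h z (h2 z hz)⟩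

theorem eqValue_inf_mono {f g f' g' f'' g'' : ℂ → ℝ}
    (h : ∀ z, f z = g z → f' z = g' z → f'' z = g'' z) :
    eqValue f g ⊓ eqValue f' g' ≤ eqValue f'' g'' := fun _ hA =>
  let ⟨N, h1, h2⟩ := mem_eqValue.1 hA.1
  let ⟨M, h3, h4⟩ := mem_eqValue.1 hA.2
  mem_eqValue.2 ⟨N ⊓ M, fun z hz => ⟨h1 z hz, h3 z hz⟩, fun z hz => h z (h2 z hz.1) (h4 z hz.2)⟩

theorem le_intR_eq {f g : extR K} (h : ∀ z, f.1 z = g.1 z) {c : Opens FinSub} :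
    c ≤ (intR K).X.eq f g := fun _ _ => mem_eqValue.2 ⟨⊤, fun _ _ => trivial, fun z _ => h z⟩

/-- The inequality must hold near `A`, not merely on it; this is why the later arguments need strict
bounds. -/
theorem mem_intR_le {f g : extR K} {A : FinSub} :
    A ∈ (intR K).le f g ↔ ∃ N : Opens ℂ, (∀ z ∈ A.1, z ∈ N) ∧ ∀ z ∈ N, f.1 z ≤ g.1 z := by
  refine mem_eqValue.trans (exists_congr fun N => and_congr_right fun _ => forall₂_congr
    fun z _ => ?_)
  exact sup_eq_right

theorem intR_rat_apply (q : ℚ) (z : ℂ) : (Subtype.val ((intR K).rat q : extR K)) z = q := by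
  change ((q : K) : ℝ) * 1 = q
  simp

theorem mem_intR_le_rat {f : extR K} {q : ℚ} {A : FinSub} :
    A ∈ (intR K).le f ((intR K).rat q) ↔
      ∃ N : Opens ℂ, (∀ z ∈ A.1, z ∈ N) ∧ ∀ z ∈ N, f.1 z ≤ q := by
  refine mem_intR_le.trans ?_
  simp only [intR_rat_apply]

theorem mem_intR_rat_le {f : extR K} {q : ℚ} {A : FinSub} :
    A ∈ (intR K).le ((intR K).rat q) f ↔
      ∃ N : Opens ℂ, (∀ z ∈ A.1, z ∈ N) ∧ ∀ z ∈ N, q ≤ f.1 z := by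
  refine mem_intR_le.trans ?_
  simp only [intR_rat_apply]

/-- A finite set of points forces `q > f` iff `f` is less than `q` at each of the points. -/
theorem mem_intR_upperCut {f : extR K} {q : ℚ} {A : FinSub} :
    A ∈ (intR K).upperCut f q ↔ ∀ z ∈ A.1, f.1 z < q := by
  have hf := continuous_of_mem_extR f.2
  unfold RieszSig.upperCut
  rw [mem_exQ]
  constructor
  · rintro ⟨p, h1, h2⟩ z hz
    obtain ⟨N, hA, hN⟩ := mem_intR_le_rat.1 h2
    have hpq : p < q := mem_ext.1 h1
    exact (hN z (hA z hz)).trans_lt (by exact_mod_cast hpq)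
  · intro h
    obtain ⟨a, ha, hmax⟩ := A.1.exists_max_image f.1 A.2
    -- A rational strictly above the maximum on `A` leaves room for an open neighbourhood of `A`.
    obtain ⟨p, h1, h2⟩ := exists_rat_btwn (h a ha)
    refine ⟨p, mem_ext.2 (by exact_mod_cast h2), mem_intR_le_rat.2
      ⟨⟨{z | f.1 z < p}, isOpen_lt hf continuous_const⟩, fun z hz => ?_, fun z hz => le_of_lt hz⟩⟩
    exact (hmax z hz).trans_lt h1

theorem mem_compl_intR_upperCut {f : extR K} {q : ℚ} {A : FinSub}
    (h : ∃ z ∈ A.1, q < f.1 z) : A ∈ ((intR K).upperCut f q)ᶜ := by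
  refine mem_compl_of_disjoint (V := ⟨_, isOpen_meets
    (isOpen_lt continuous_const (continuous_of_mem_extR f.2))⟩) h ?_
  rintro B ⟨z, hz, hlt⟩ hB
  exact lt_asymm (mem_intR_upperCut.1 hB z hz) hlt

/-! ### Riesz space axioms. -/

theorem intR_opsWellDefined : ⊤ ≤ (intR K).opsWellDefined := by
  refine le_inf (le_inf (le_inf (le_intR_eq fun _ => rfl) (le_intR_eq fun _ => rfl)) ?_) ?_
  · refine HSet.le_all fun f => HSet.le_all fun f' => HSet.le_all fun g => HSet.le_all fun g' =>
      le_himp_iff.2 (inf_le_right.trans (le_inf (le_inf ?_ ?_) ?_))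
    · exact eqValue_inf_mono fun z h h' => congrArg₂ (· + ·) h h'
    · exact eqValue_inf_mono fun z h h' => congrArg₂ (· ⊔ ·) h h'
    · exact eqValue_inf_mono fun z h h' => congrArg₂ (· ⊓ ·) h h'
  · refine RieszSig.le_allScalar fun k => HSet.le_all fun f => HSet.le_all fun f' =>
      le_himp_iff.2 (inf_le_right.trans ?_)
    exact eqValue_mono fun z h => congrArg ((k : ℝ) * ·) h

theorem intR_vectorSpaceAxioms : ⊤ ≤ (intR K).vectorSpaceAxioms := by
  refine le_inf (le_inf (le_inf (le_inf (le_inf (le_inf (le_inf ?_ ?_) ?_) ?_) ?_) ?_) ?_) ?_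
  · exact HSet.le_all fun f => HSet.le_all fun g => le_intR_eq fun z => add_comm (f.1 z) (g.1 z)
  · exact HSet.le_all fun f => HSet.le_all fun g => HSet.le_all fun h =>
      le_intR_eq fun z => add_assoc (f.1 z) (g.1 z) (h.1 z)
  · exact HSet.le_all fun f => le_intR_eq fun z => add_zero (f.1 z)
  · refine HSet.le_all fun f => le_intR_eq fun z => ?_
    change f.1 z + ((-1 : K) : ℝ) * f.1 z = 0
    push_cast
    ring
  · exact HSet.le_all fun f => le_intR_eq fun z => one_mul (f.1 z)
  · exact RieszSig.le_allScalar fun k => RieszSig.le_allScalar fun l => HSet.le_all fun f =>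
      le_intR_eq fun z => mul_assoc (k : ℝ) l (f.1 z)
  · exact RieszSig.le_allScalar fun k => RieszSig.le_allScalar fun l => HSet.le_all fun f =>
      le_intR_eq fun z => add_mul (k : ℝ) l (f.1 z)
  · exact RieszSig.le_allScalar fun k => HSet.le_all fun f => HSet.le_all fun g =>
      le_intR_eq fun z => mul_add (k : ℝ) (f.1 z) (g.1 z)

theorem intR_latticeAxioms : ⊤ ≤ (intR K).latticeAxioms := by
  refine le_inf ?_ ?_
  · refine HSet.le_all fun f => HSet.le_all fun g => le_inf (le_inf (le_inf ?_ ?_) ?_) ?_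
    · exact le_intR_eq fun z => sup_comm (f.1 z) (g.1 z)
    · exact le_intR_eq fun z => inf_comm (f.1 z) (g.1 z)
    · exact le_intR_eq fun z => sup_inf_self (a := f.1 z) (b := g.1 z)
    · exact le_intR_eq fun z => inf_sup_self (a := f.1 z) (b := g.1 z)
  · refine HSet.le_all fun f => HSet.le_all fun g => HSet.le_all fun h => le_inf ?_ ?_
    · exact le_intR_eq fun z => sup_assoc (f.1 z) (g.1 z) (h.1 z)
    · exact le_intR_eq fun z => inf_assoc (f.1 z) (g.1 z) (h.1 z)

theorem intR_orderAxioms : ⊤ ≤ (intR K).orderAxioms := by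
  refine le_inf ?_ ?_
  · refine HSet.le_all fun f => HSet.le_all fun g => HSet.le_all fun h =>
      le_himp_iff.2 (inf_le_right.trans fun A hA => ?_)
    obtain ⟨N, h1, h2⟩ := mem_intR_le.1 hA
    exact mem_intR_le.2 ⟨N, h1, fun z hz => add_le_add (h2 z hz) (le_refl (h.1 z))⟩
  · refine RieszSig.le_allScalar fun k => HSet.le_all fun f => HSet.le_all fun g =>
      le_himp_iff.2 (inf_le_right.trans fun A hA => ?_)
    obtain ⟨N, h1, h2⟩ := mem_intR_le.1 hA.2
    have hk : (0 : ℝ) ≤ k := mem_ext.1 hA.1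
    exact mem_intR_le.2 ⟨N, h1, fun z hz => mul_le_mul_of_nonneg_left (h2 z hz) hk⟩

theorem intR_isRieszSpace : ⊤ ≤ (intR K).isRieszSpace :=
  le_inf (le_inf (le_inf intR_opsWellDefined intR_vectorSpaceAxioms) intR_latticeAxioms)
    intR_orderAxioms

/-! ### Strong unit, embedding of the rationals, located cuts. -/

theorem intR_oneIsStrongUnit : ⊤ ≤ (intR K).oneIsStrongUnit := by
  refine HSet.le_all fun f A _ => ?_
  have hf := continuous_of_mem_extR f.2
  rw [HSet.check_ex, Opens.mem_iSup]
  obtain ⟨a, -, hmax⟩ := A.1.exists_max_image (fun z => |f.1 z|) A.2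
  obtain ⟨n, hn⟩ := exists_nat_gt |f.1 a|
  have hN : IsOpen {z | |f.1 z| < n} := isOpen_lt hf.abs continuous_const
  have hA : ∀ z ∈ A.1, z ∈ (⟨_, hN⟩ : Opens ℂ) := fun z hz => (hmax z hz).trans_lt hn
  refine ⟨n, mem_intR_rat_le.2 ⟨_, hA, fun z hz => ?_⟩, mem_intR_le_rat.2 ⟨_, hA, fun z hz => ?_⟩⟩
  · push_cast
    exact (abs_lt.1 hz).1.le
  · push_cast
    exact (abs_lt.1 hz).2.le

theorem intR_ratEmbeds : ⊤ ≤ (intR K).ratEmbeds := by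
  refine le_allQ fun p => le_allQ fun q => le_biImp_of_eq ?_
  ext A
  change A ∈ (ext (p ≤ q) : Opens FinSub) ↔ A ∈ (intR K).le ((intR K).rat p) ((intR K).rat q)
  refine mem_ext.trans (Iff.trans ?_ mem_intR_le.symm)
  simp only [intR_rat_apply, Rat.cast_le]
  refine ⟨fun h => ⟨⊤, fun _ _ => trivial, fun _ _ => h⟩, ?_⟩
  rintro ⟨N, h1, h2⟩
  -- Non-emptiness of `A` is what reflects the order of constants.
  obtain ⟨z, hz⟩ := A.2
  exact h2 z (h1 z hz)

theorem intR_isLocatedUpperCut (f : extR K) :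
    ⊤ ≤ isLocatedUpperCut ((intR K).upperCut f) := by
  refine le_inf (le_inf (le_inf (fun A _ => mem_exQ.2 ?_) fun A _ => mem_exQ.2 ?_) ?_) ?_
  · obtain ⟨a, -, hmax⟩ := A.1.exists_max_image f.1 A.2
    obtain ⟨q, hq⟩ := exists_rat_gt (f.1 a)
    exact ⟨q, mem_intR_upperCut.2 fun z hz => (hmax z hz).trans_lt hq⟩
  · obtain ⟨a, ha⟩ := A.2
    obtain ⟨q, hq⟩ := exists_rat_lt (f.1 a)
    exact ⟨q, mem_compl_intR_upperCut ⟨a, ha, hq⟩⟩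
  · refine le_allQ fun q => le_biImp_of_eq ?_
    ext A
    refine Iff.trans ?_ mem_exQ.symm
    constructor
    · intro h
      obtain ⟨a, ha, hmax⟩ := A.1.exists_max_image f.1 A.2
      obtain ⟨p, h1, h2⟩ := exists_rat_btwn (mem_intR_upperCut.1 h a ha)
      exact ⟨p, mem_ext.2 (by exact_mod_cast h2),
        mem_intR_upperCut.2 fun z hz => (hmax z hz).trans_lt h1⟩
    · rintro ⟨p, h1, h2⟩
      have hpq : p < q := mem_ext.1 h1
      exact mem_intR_upperCut.2 fun z hz =>
        (mem_intR_upperCut.1 h2 z hz).trans (by exact_mod_cast hpq)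
  · refine le_allQ fun p => le_allQ fun q => le_himp_iff.2 fun A hA => ?_
    have hpq : p < q := mem_ext.1 hA.2
    have hpq : (p : ℝ) < q := by exact_mod_cast hpq
    -- The case split is made outside the model, separately at each `A`.
    by_cases h : ∀ z ∈ A.1, f.1 z < q
    · exact Or.inr (mem_intR_upperCut.2 h)
    · push Not at h
      obtain ⟨z, hz, hle⟩ := h
      exact Or.inl (mem_compl_intR_upperCut ⟨z, hz, hpq.trans_le hle⟩)

theorem intR_isNormable : ⊤ ≤ (intR K).isNormable :=
  le_inf (le_inf (le_inf intR_isRieszSpace intR_oneIsStrongUnit) intR_ratEmbeds)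
    (HSet.le_all intR_isLocatedUpperCut)

/-! ### Bounds on the supremum from conditions in normal form. -/

/-- Positive information: a set in the condition has a point in every `O i`, so any `q` in the cut
exceeds a value of `r` there. -/
theorem normalOpen_le_leCut {n : ℕ} {O : Fin n → Opens ℂ} {r : extR K} {m : Fin n → ℝ} {l : ℝ}
    (hm : ∀ i, m i ∈ lowerBounds (r.1 '' (O i : Set ℂ))) (hl : IsLUB (Set.range m) l) :
    normalOpen O ≤ leCut l ((intR K).upperCut r) := by
  refine le_allQ fun q => le_himp_iff.2 fun B hB => mem_ext.2 (hl.2 ?_)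
  rintro _ ⟨i, rfl⟩
  obtain ⟨z, hz, hzO⟩ := hB.1.1 i
  exact (hm i ⟨z, hzO, rfl⟩).trans (mem_intR_upperCut.1 hB.2 z hz).le

/-- Negative information: all points lie in the union, where `r` is at most `u`. -/
theorem normalOpen_le_cutLe {n : ℕ} {O : Fin n → Opens ℂ} {r : extR K} {u : ℝ}
    (hu : u ∈ upperBounds (r.1 '' (⋃ i, (O i : Set ℂ)))) :
    normalOpen O ≤ cutLe ((intR K).upperCut r) u := by
  refine le_allQ fun q => le_himp_iff.2 fun B hB => mem_intR_upperCut.2 fun z hz => ?_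
  obtain ⟨i, hi⟩ := Opens.mem_iSup.1 (hB.1.2 z hz)
  exact (hu ⟨z, Set.mem_iUnion.2 ⟨i, hi⟩, rfl⟩).trans_lt (mem_ext.1 hB.2)

/-- Points of a finite set have disjoint open neighbourhoods on which a given continuous function
is nearly constant. -/
theorem exists_disjoint_opens {f : ℂ → ℝ} (hf : Continuous f) (A : Finset ℂ) {δ : ℝ} (hδ : 0 < δ) :
    ∃ (a : Fin A.card → ℂ) (O : Fin A.card → Opens ℂ), Set.range a = A ∧ (∀ i, a i ∈ O i) ∧
      Pairwise (fun i j => Disjoint (O i) (O j)) ∧ ∀ i, ∀ z ∈ O i, |f z - f (a i)| < δ := by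
  obtain ⟨U, hU, hd⟩ := A.finite_toSet.t2_separation
  let e := A.equivFin.symm
  refine ⟨fun i => e i, fun i => ⟨U (e i) ∩ {z | |f z - f (e i)| < δ}, (hU _).2.inter
    (isOpen_lt (hf.sub continuous_const).abs continuous_const)⟩, ?_, fun i => ⟨(hU _).1, ?_⟩, ?_,
    fun i z hz => hz.2⟩
  · ext z
    constructor
    · rintro ⟨i, rfl⟩
      exact (e i).2
    · exact fun hz => ⟨A.equivFin ⟨z, hz⟩, by simp [e]⟩
  · simpa using hδ
  · intro i j hij
    rw [← Opens.coe_disjoint]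
    exact (hd (e i).2 (e j).2 fun h => hij (e.injective (Subtype.ext h))).mono
      Set.inter_subset_left Set.inter_subset_left

end TopModel

theorem proposition9 (K : Subfield ℝ) :
    TopModel.Forces (⊤ : TopologicalSpace.Opens TopModel.FinSub) (TopModel.intR K).isNormable ∧
    ∀ (r : TopModel.extR K) (A : TopModel.FinSub) (ε : ℝ), 0 < ε →
      ∃ (n : ℕ) (O : Fin n → TopologicalSpace.Opens ℂ) (m : Fin n → ℝ) (l u : ℝ),
        Pairwise (fun i j => Disjoint (O i) (O j)) ∧
        A ∈ TopModel.normalOpen O ∧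
        (∀ i, IsGLB (r.1 '' (O i : Set ℂ)) (m i)) ∧
        IsLUB (Set.range m) l ∧
        IsLUB (r.1 '' (⋃ i, (O i : Set ℂ))) u ∧
        u - l < ε ∧
        TopModel.Forces (TopModel.normalOpen O)
          (TopModel.leCut l ((TopModel.intR K).upperCut r)) ∧
        TopModel.Forces (TopModel.normalOpen O)
          (TopModel.cutLe ((TopModel.intR K).upperCut r) u) := by
  refine ⟨TopModel.intR_isNormable, fun r A ε hε => ?_⟩
  obtain ⟨a, O, ha, haO, hd, hO⟩ := TopModel.exists_disjoint_opens
    -- Both `l` and `u` will be within `ε / 3` of the maximum of `r` on `A`, so they differ by at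
    -- most `2 * ε / 3`.
    (TopModel.continuous_of_mem_extR r.2) A.1 (δ := ε / 3) (by positivity)
  obtain ⟨b, hb, hmax⟩ := A.1.exists_max_image r.1 A.2
  have haA : ∀ i, a i ∈ A.1 := fun i => by
    have := Set.mem_range_self (f := a) i
    rwa [ha] at this
  have hAa : ∀ z ∈ A.1, ∃ i, a i = z := fun z hz => by
    have : z ∈ (A.1 : Set ℂ) := hz
    rwa [← ha] at this
  obtain ⟨i₀, rfl⟩ := hAa b hb
  have hlow : ∀ i, r.1 (a i) - ε / 3 ∈ lowerBounds (r.1 '' (O i : Set ℂ)) := by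
    rintro i _ ⟨z, hz, rfl⟩
    linarith [(abs_lt.1 (hO i z hz)).1]
  have hup : r.1 (a i₀) + ε / 3 ∈ upperBounds (r.1 '' (⋃ i, (O i : Set ℂ))) := by
    rintro _ ⟨z, hz, rfl⟩
    obtain ⟨i, hi⟩ := Set.mem_iUnion.1 hz
    linarith [(abs_lt.1 (hO i z hi)).2, hmax (a i) (haA i)]
  have hm : ∀ i, IsGLB (r.1 '' (O i : Set ℂ)) (sInf (r.1 '' (O i : Set ℂ))) := fun i =>
    isGLB_csInf ⟨_, a i, haO i, rfl⟩ ⟨_, hlow i⟩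
  have hl := isLUB_csSup (Set.range_nonempty_iff_nonempty.2 ⟨i₀⟩)
    (Set.finite_range fun i => sInf (r.1 '' (O i : Set ℂ))).bddAbove
  have hu := isLUB_csSup (s := r.1 '' (⋃ i, (O i : Set ℂ)))
    ⟨_, a i₀, Set.mem_iUnion.2 ⟨i₀, haO i₀⟩, rfl⟩ ⟨_, hup⟩
  refine ⟨_, O, _, _, _, hd, ⟨fun i => ⟨a i, haA i, haO i⟩, fun z hz => ?_⟩, hm, hl, hu, ?_,
    TopModel.normalOpen_le_leCut (fun i => (hm i).1) hl, TopModel.normalOpen_le_cutLe hu.1⟩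
  · obtain ⟨i, rfl⟩ := hAa z hz
    exact TopologicalSpace.Opens.mem_iSup.2 ⟨i, haO i⟩
  -- The index `i₀` of a maximum point alone gives `l ≥ r (a i₀) - ε / 3`.
  · linarith [hu.2 hup, (hm i₀).2 (hlow i₀), hl.1 (Set.mem_range_self i₀)]
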